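/- Let $K$ be a field, let $t\ge 1$ and $n_1,\dots,n_t\ge 1$ be integers, and let $A=UT(n_1,\dots,n_t)$ be the $K$-algebra of upper block triangular matrices over $K$ with blocks $A_{ij}$ ($1\le i\le j\le t$) of size $n_i\times n_j$. Let $G$ be any group (not necessarily abelian or finite). A $G$-grading on an algebra $R$ is a vector space decomposition $R=\bigoplus_{g\in G}R_g$ with $R_gR_h\subseteq R_{gh}$ for all $g,h\in G$; non-zero elements of $R_g$ are called homogeneous of degree $g$. It is a division grading if every non-zero homogeneous element is invertible in $R$. Suppose that $\operatorname{char}K=0$ or $\operatorname{char}K>\dim_K A$. Then for every $G$-grading on $A$ there exist - an integer $n\ge 1$ and a division $G$-grading on $D=M_n(K)$, - integers $n_1',\dots,n_t'\ge 1$ and, with $N=n_1'+\dots+n_t'$, a sequence $(g_1,\dots,g_N)\in G^N$, defining an elementary $G$-grading on $B=UT(n_1',\dots,n_t')$, that is, one in which every matrix unit $e_{ij}\in B$ is homogeneous of degree $g_ig_j^{-1}$, such that setting $$\deg(e_{ij}\otimes d)=g_i\,(\deg d)\,g_j^{-1}\qquad(e_{ij}\in B,\ d\in D\text{ homogeneous})$$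 defines a $G$-grading on $B\otimes_K D$, and $A$ is isomorphic to $B\otimes_K D$ as a $G$-graded algebra, i.e. there is an isomorphism of $K$-algebras $A\to B\otimes_K D$ that maps the homogeneous component of degree $g$ of $A$ onto that of $B\otimes_K D$ for every $g\in G$. -/

import Mathlib

open scoped TensorProduct

/-- A `G`-grading on a `K`-algebra `A`: a vector space decomposition `A = ⨁ g, 𝒜 g`
with `𝒜 g * 𝒜 h ⊆ 𝒜 (g * h)`.  The group `G` is written multiplicatively and is arbitrary. -/
structure IsGroupGrading {G K A : Type*} [Group G] [Field K] [Ring A] [Algebra K A]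
    (𝒜 : G → Submodule K A) : Prop where
  independent : iSupIndep 𝒜
  iSup_eq_top : ⨆ g, 𝒜 g = ⊤
  mul_mem : ∀ {g h : G} {a b : A}, a ∈ 𝒜 g → b ∈ 𝒜 h → a * b ∈ 𝒜 (g * h)

/-- A division grading: a grading for which every non-zero homogeneous element is invertible. -/
structure IsDivisionGrading {G K A : Type*} [Group G] [Field K] [Ring A] [Algebra K A]
    (𝒜 : G → Submodule K A) : Prop extends IsGroupGrading 𝒜 where
  isUnit : ∀ {g : G} {a : A}, a ∈ 𝒜 g → a ≠ 0 → IsUnit a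

/-- The row (and column) indices of `UT(n₁, …, n_t)`: pairs of a block `k` and a position
in that block. -/
abbrev UTIndex {t : ℕ} (n : Fin t → ℕ) : Type := Σ k : Fin t, Fin (n k)

/-- The algebra `UT(n₁, …, n_t)` of upper block triangular matrices over `K`, whose
`(i, j)` block is an `n i × n j` matrix, and is zero for `j < i`. -/
def UT (K : Type*) [Field K] {t : ℕ} (n : Fin t → ℕ) :
    Subalgebra K (Matrix (UTIndex n) (UTIndex n) K) where
  carrier := {M | M.BlockTriangular Sigma.fst}
  mul_mem' := fun ha hb => ha.mul hb
  add_mem' := fun ha hb => ha.add hb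
  algebraMap_mem' := fun r i j hij => by
    have hne : i ≠ j := fun h => by subst h; exact lt_irrefl _ hij
    simp [Matrix.algebraMap_matrix_apply, hne]

/-- The matrix unit `e_ij`, as an element of `UT(n₁, …, n_t)`; it exists if the block of `i`
does not come after the block of `j`. -/
def UT.unit (K : Type*) [Field K] {t : ℕ} (n : Fin t → ℕ) (i j : UTIndex n)
    (hij : i.1 ≤ j.1) : UT K n :=
  ⟨Matrix.single i j 1, fun a b hab => by
    refine Matrix.single_apply_of_ne _ _ _ _ _ ?_
    rintro ⟨rfl, rfl⟩
    exact absurd hab (not_lt.mpr hij)⟩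

/-- The grading `ℬ` on `UT(n₁, …, n_t)` is elementary, defined by the sequence `γ` of elements
of `G`: every matrix unit `e_ij` of the algebra is homogeneous of degree `γ_i γ_j⁻¹`. -/
structure IsElementaryGrading {G K : Type*} [Group G] [Field K] {t : ℕ} {n : Fin t → ℕ}
    (γ : UTIndex n → G) (ℬ : G → Submodule K (UT K n)) : Prop extends IsGroupGrading ℬ where
  unit_mem : ∀ (i j : UTIndex n) (hij : i.1 ≤ j.1), UT.unit K n i j hij ∈ ℬ (γ i * (γ j)⁻¹)

/-- The homogeneous components of `UT(n₁, …, n_t) ⊗ D`, where `deg (e_ij ⊗ d) = γ_i (deg d) γ_j⁻¹`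
for homogeneous `d`: the component of degree `g` is spanned by all `e_ij ⊗ d` of degree `g`. -/
def tensorGrading {G K D : Type*} [Group G] [Field K] [Ring D] [Algebra K D] {t : ℕ}
    {n : Fin t → ℕ} (γ : UTIndex n → G) (𝒟 : G → Submodule K D) (g : G) :
    Submodule K (UT K n ⊗[K] D) :=
  Submodule.span K {x | ∃ (i j : UTIndex n) (hij : i.1 ≤ j.1) (h : G) (d : D),
    d ∈ 𝒟 h ∧ γ i * h * (γ j)⁻¹ = g ∧ x = UT.unit K n i j hij ⊗ₜ[K] d}

/-! Let J be the ideal of strictly upper block triangular matrices. Left multiplication by a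
homogeneous element of degree ≠ 1 moves every component, so its trace on A is zero; hence the
radical of the trace form (a, b) ↦ tr(L_{ab}) is graded. The trace of L_a is the sum of the a_ii
with multiplicities between 1 and dim A, which are non-zero in K by the assumption on the
characteristic, so this radical is J (`UT.mem_radical_iff_trace`, `UT.proj_mem_radical`).

The last block column of A is the left annihilator of J, hence a graded left ideal. So some V = K^ι
⊗ K^m with m > 0, written as ι × m matrices, is a graded A-module. Take m minimal. The endomorphisms
of V over A are the right multiplications by M_m(K), which become a graded algebra D acting on the
right, so that deg(xd) = deg(x) deg(d) even for non-abelian G. The image of a non-zero homogeneous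
endomorphism is again a graded module of the form K^ι ⊗ K^r with r > 0; minimality gives r = m, so D
is a graded division algebra (`IsGradedModule.isDivisionGrading_rightComponent`).

The flag of A-submodules of V given by the blocks is determined by J, so it is graded. Graded
D-modules have homogeneous bases, so there is a homogeneous D-basis u of V adapted to the flag, with
n'_k elements in the k-th quotient (`IsGradedModule.exists_adapted_basis`). Expressing the action of
A on V in this basis identifies A with UT(n') ⊗ D: the element that sends u_j to u_i d and kills the
other u_l has degree γ_i deg(d) γ_j⁻¹. -/

/-- A vector space decomposition of `M` indexed by `G`. -/
structure IsDecomposition {G K M : Type*} [Field K] [AddCommGroup M] [Module K M]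
    (𝒰 : G → Submodule K M) : Prop where
  independent : iSupIndep 𝒰
  iSup_eq_top : ⨆ g, 𝒰 g = ⊤

theorem IsGroupGrading.isDecomposition {G K A : Type*} [Group G] [Field K] [Ring A] [Algebra K A]
    {𝒜 : G → Submodule K A} (h : IsGroupGrading 𝒜) : IsDecomposition 𝒜 :=
  ⟨h.independent, h.iSup_eq_top⟩

theorem LinearMap.ext_on_iSup {G K M M' : Type*} [Field K] [AddCommGroup M] [Module K M]
    [AddCommGroup M'] [Module K M'] {𝒰 : G → Submodule K M} (h𝒰 : ⨆ g, 𝒰 g = ⊤)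
    {f f' : M →ₗ[K] M'} (h : ∀ g, ∀ x ∈ 𝒰 g, f x = f' x) (x : M) : f x = f' x := by
  have : (⨆ g, 𝒰 g) ≤ LinearMap.eqLocus f f' := iSup_le fun g x hx => h g x hx
  exact this (h𝒰 ▸ Submodule.mem_top)

/-! ### Homogeneous projections -/

section Projections

variable {G K M M' : Type*} [Field K] [AddCommGroup M] [Module K M] [AddCommGroup M'] [Module K M']

theorem iSupIndep_of_projections {𝒰 : G → Submodule K M} (π : G → M →ₗ[K] M)
    (h1 : ∀ g, ∀ x ∈ 𝒰 g, π g x = x) (h2 : ∀ g h, g ≠ h → ∀ x ∈ 𝒰 h, π g x = 0) :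
    iSupIndep 𝒰 := by
  intro g
  rw [Submodule.disjoint_def]
  intro x hx hx'
  have : (⨆ (h) (_ : h ≠ g), 𝒰 h) ≤ LinearMap.ker (π g) :=
    iSup₂_le fun h hh y hy => h2 g h hh.symm y hy
  rw [← h1 g x hx]
  exact this hx'

namespace IsDecomposition

variable {𝒰 : G → Submodule K M} (h𝒰 : IsDecomposition 𝒰)

theorem exists_projections (h𝒰 : IsDecomposition 𝒰) : ∃ π : G → M →ₗ[K] M,
    (∀ g x, π g x ∈ 𝒰 g) ∧ (∀ g, ∀ x ∈ 𝒰 g, π g x = x) ∧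
      ∀ g h, g ≠ h → ∀ x ∈ 𝒰 h, π g x = 0 := by
  classical
  let _ := (DirectSum.isInternal_submodule_of_iSupIndep_of_iSup_eq_top h𝒰.independent
    h𝒰.iSup_eq_top).chooseDecomposition
  refine ⟨fun g => (𝒰 g).subtype ∘ₗ DirectSum.component K G (fun i => 𝒰 i) g ∘ₗ
    (DirectSum.decomposeLinearEquiv 𝒰).toLinearMap, fun g x => Subtype.property _,
    fun g x hx => ?_, fun g h hgh x hx => ?_⟩
  · exact DirectSum.decompose_of_mem_same 𝒰 hx
  · exact DirectSum.decompose_of_mem_ne 𝒰 hx hgh.symm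

/-- The projection onto the homogeneous component of degree `g`. -/
noncomputable def proj (g : G) : M →ₗ[K] M := h𝒰.exists_projections.choose g

theorem proj_mem (g : G) (x : M) : h𝒰.proj g x ∈ 𝒰 g :=
  h𝒰.exists_projections.choose_spec.1 g x

theorem proj_of_mem {g : G} {x : M} (hx : x ∈ 𝒰 g) : h𝒰.proj g x = x :=
  h𝒰.exists_projections.choose_spec.2.1 g x hx

theorem proj_of_mem_ne {g h : G} (hgh : g ≠ h) {x : M} (hx : x ∈ 𝒰 h) : h𝒰.proj g x = 0 :=
  h𝒰.exists_projections.choose_spec.2.2 g h hgh x hx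

theorem exists_support (h𝒰 : IsDecomposition 𝒰) [FiniteDimensional K M] :
    ∃ S : Finset G, ∀ g, g ∉ S → 𝒰 g = ⊥ := by
  have := WellFoundedGT.finite_ne_bot_of_iSupIndep h𝒰.independent
  exact ⟨this.toFinset, fun g hg => by simpa using hg⟩

theorem sum_proj {S : Finset G} (hS : ∀ g, g ∉ S → 𝒰 g = ⊥) (x : M) :
    ∑ g ∈ S, h𝒰.proj g x = x := by
  rw [← LinearMap.sum_apply]
  refine LinearMap.ext_on_iSup (f' := LinearMap.id) h𝒰.iSup_eq_top (fun g y hy => ?_) x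
  rw [LinearMap.sum_apply, LinearMap.id_apply]
  by_cases hg : g ∈ S
  · rw [Finset.sum_eq_single_of_mem g hg fun h _ hh => h𝒰.proj_of_mem_ne hh hy,
      h𝒰.proj_of_mem hy]
  · have : y = 0 := by simpa [hS g hg] using hy
    simp [this]

/-- Used mostly with `f` a multiplication by a homogeneous element and `σ` a translation of the
group. Injectivity of `σ` keeps distinct components from being merged. -/
theorem proj_map {G' : Type*} {𝒰' : G' → Submodule K M'} (h𝒰' : IsDecomposition 𝒰')
    {f : M →ₗ[K] M'} {σ : G → G'} (hσ : Function.Injective σ)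
    (hf : ∀ g, ∀ x ∈ 𝒰 g, f x ∈ 𝒰' (σ g)) (g : G) (x : M) :
    h𝒰'.proj (σ g) (f x) = f (h𝒰.proj g x) := by
  refine LinearMap.ext_on_iSup (f := h𝒰'.proj (σ g) ∘ₗ f) (f' := f ∘ₗ h𝒰.proj g)
    h𝒰.iSup_eq_top (fun h y hy => ?_) x
  simp only [LinearMap.comp_apply]
  by_cases hg : g = h
  · subst hg
    rw [h𝒰.proj_of_mem hy, h𝒰'.proj_of_mem (hf _ _ hy)]
  · rw [h𝒰.proj_of_mem_ne hg hy, map_zero,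
      h𝒰'.proj_of_mem_ne (fun e => hg (hσ e)) (hf _ _ hy)]

theorem eq_zero_of_proj [FiniteDimensional K M] {x : M} (h : ∀ g, h𝒰.proj g x = 0) : x = 0 := by
  obtain ⟨S, hS⟩ := h𝒰.exists_support
  rw [← h𝒰.sum_proj hS x]
  exact Finset.sum_eq_zero fun g _ => h g

theorem mem_of_proj [FiniteDimensional K M] {W : Submodule K M} {x : M}
    (h : ∀ g, h𝒰.proj g x ∈ W) : x ∈ W := by
  obtain ⟨S, hS⟩ := h𝒰.exists_support
  rw [← h𝒰.sum_proj hS x]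
  exact W.sum_mem fun g _ => h g

theorem mem_of_proj_eq_zero [FiniteDimensional K M] {x : M} {g : G}
    (h : ∀ k, k ≠ g → h𝒰.proj k x = 0) : x ∈ 𝒰 g := by
  refine h𝒰.mem_of_proj fun k => ?_
  by_cases hk : k = g
  · exact hk ▸ h𝒰.proj_mem k x
  · rw [h k hk]; exact zero_mem _

/-- A decomposition restricts to a subspace that contains the homogeneous components of its
elements. -/
theorem comap [FiniteDimensional K M] {ι : M' →ₗ[K] M} (hι : Function.Injective ι)
    (hr : ∀ g x, h𝒰.proj g (ι x) ∈ LinearMap.range ι) :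
    IsDecomposition fun g => (𝒰 g).comap ι := by
  obtain ⟨S, hS⟩ := h𝒰.exists_support
  constructor
  · intro g
    rw [Submodule.disjoint_def]
    intro x hx hx'
    have : (⨆ (h) (_ : h ≠ g), (𝒰 h).comap ι) ≤ LinearMap.ker (h𝒰.proj g ∘ₗ ι) :=
      iSup₂_le fun h hh y hy => h𝒰.proj_of_mem_ne hh.symm hy
    have h0 : h𝒰.proj g (ι x) = 0 := this hx'
    rw [h𝒰.proj_of_mem hx] at h0
    exact hι (by rw [h0, map_zero])
  · rw [eq_top_iff]
    intro x _
    choose y hy using fun g => hr g x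
    have hx : x = ∑ g ∈ S, y g := hι (by
      rw [map_sum, ← h𝒰.sum_proj hS (ι x)]
      exact Finset.sum_congr rfl fun g _ => (hy g).symm)
    rw [hx]
    refine Submodule.sum_mem _ fun g _ => Submodule.mem_iSup_of_mem g ?_
    rw [Submodule.mem_comap, hy]
    exact h𝒰.proj_mem g _

/-- A spanning family contained componentwise in a decomposition is equal to it. -/
theorem eq_of_le (h𝒰 : IsDecomposition 𝒰) {𝒱 : G → Submodule K M} (h : ∀ g, 𝒱 g ≤ 𝒰 g)
    (htop : ⨆ g, 𝒱 g = ⊤) (g : G) :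
    𝒱 g = 𝒰 g := by
  refine le_antisymm (h g) fun x hx => ?_
  have hx' : h𝒰.proj g x ∈ 𝒱 g := by
    have : (⨆ k, 𝒱 k) ≤ (𝒱 g).comap (h𝒰.proj g) := iSup_le fun k y hy => by
      rw [Submodule.mem_comap]
      by_cases hk : g = k
      · subst hk
        rwa [h𝒰.proj_of_mem (h _ hy)]
      · rw [h𝒰.proj_of_mem_ne hk (h _ hy)]
        exact zero_mem _
    exact this (htop ▸ Submodule.mem_top)
  rwa [h𝒰.proj_of_mem hx] at hx'

end IsDecomposition

end Projections

/-! ### Transport of gradings and traces of homogeneous elements -/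

theorem IsGroupGrading.map_algEquiv {G K A B : Type*} [Group G] [Field K] [Ring A] [Algebra K A]
    [Ring B] [Algebra K B] {𝒜 : G → Submodule K A} (h𝒜 : IsGroupGrading 𝒜) (φ : A ≃ₐ[K] B) :
    IsGroupGrading fun g => (𝒜 g).map φ.toLinearMap where
  independent := by
    refine iSupIndep_of_projections
      (fun g => φ.toLinearMap ∘ₗ h𝒜.isDecomposition.proj g ∘ₗ φ.symm.toLinearMap) ?_ ?_
    · rintro g _ ⟨x, hx, rfl⟩
      simp [h𝒜.isDecomposition.proj_of_mem hx]
    · rintro g h hgh _ ⟨x, hx, rfl⟩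
      simp [h𝒜.isDecomposition.proj_of_mem_ne hgh hx]
  iSup_eq_top := by
    rw [← Submodule.map_iSup, h𝒜.iSup_eq_top, Submodule.map_top]
    exact LinearMap.range_eq_top.2 φ.surjective
  mul_mem := by
    rintro g h _ _ ⟨a, ha, rfl⟩ ⟨b, hb, rfl⟩
    exact ⟨a * b, h𝒜.mul_mem ha hb, by simp⟩

/-- Since gh ≠ h for all h, left multiplication by a has no diagonal blocks with respect to the
grading. -/
theorem IsGroupGrading.trace_mulLeft {G K A : Type*} [Group G] [Field K] [Ring A] [Algebra K A]
    [FiniteDimensional K A] {𝒜 : G → Submodule K A} (h𝒜 : IsGroupGrading 𝒜) {g : G} (hg : g ≠ 1)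
    {a : A} (ha : a ∈ 𝒜 g) : LinearMap.trace K A (LinearMap.mulLeft K a) = 0 := by
  classical
  exact LinearMap.trace_eq_zero_of_mapsTo_ne
    (DirectSum.isInternal_submodule_of_iSupIndep_of_iSup_eq_top h𝒜.independent h𝒜.iSup_eq_top)
    (fun h => g * h) (fun h => by simpa using hg) fun h b hb => h𝒜.mul_mem ha hb

/-! ### The trace form and the radical of the block triangular algebra -/

namespace UT

variable {K : Type*} [Field K] {t : ℕ} {n : Fin t → ℕ}

theorem apply_eq_zero (a : UT K n) {i j : UTIndex n} (h : j.1 < i.1) :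
    (a : Matrix (UTIndex n) (UTIndex n) K) i j = 0 :=
  a.2 h

@[simp]
theorem coe_unit (i j : UTIndex n) (hij : i.1 ≤ j.1) :
    (UT.unit K n i j hij : Matrix (UTIndex n) (UTIndex n) K) = Matrix.single i j 1 := rfl

/-- An element of `UT(n₁, …, n_t)` is determined by its entries in the blocks on or above the
diagonal, which are arbitrary. -/
def entriesEquiv (K : Type*) [Field K] {t : ℕ} (n : Fin t → ℕ) :
    UT K n ≃ₗ[K] ({p : UTIndex n × UTIndex n // p.1.1 ≤ p.2.1} → K) where
  toFun a p := (a : Matrix (UTIndex n) (UTIndex n) K) p.1.1 p.1.2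
  map_add' _ _ := rfl
  map_smul' _ _ := rfl
  invFun f := ⟨Matrix.of fun i j => if h : i.1 ≤ j.1 then f ⟨(i, j), h⟩ else 0,
    fun i j hij => by
      rw [Matrix.of_apply, dif_neg (not_le.2 hij)]⟩
  left_inv a := by
    ext i j
    by_cases h : i.1 ≤ j.1
    · simp [h]
    · simp [h, apply_eq_zero a (not_le.1 h)]
  right_inv f := by
    ext p
    simp [p.2]

instance : FiniteDimensional K (UT K n) :=
  Module.Finite.equiv (entriesEquiv K n).symm

theorem finrank_eq : Module.finrank K (UT K n) =
    Fintype.card {p : UTIndex n × UTIndex n // p.1.1 ≤ p.2.1} := by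
  rw [(entriesEquiv K n).finrank_eq, Module.finrank_fintype_fun_eq_card]

theorem entriesEquiv_symm_single (p : {p : UTIndex n × UTIndex n // p.1.1 ≤ p.2.1}) :
    (entriesEquiv K n).symm (Pi.single p 1) = UT.unit K n p.1.1 p.1.2 p.2 := by
  rw [LinearEquiv.symm_apply_eq]
  ext q
  obtain ⟨⟨i, j⟩, h⟩ := p
  obtain ⟨⟨i', j'⟩, h'⟩ := q
  change _ = Matrix.single i j (1 : K) i' j'
  rw [Matrix.single_apply, Pi.single_apply]
  simp only [Subtype.mk.injEq, Prod.mk.injEq]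
  congr 1
  simp [eq_comm]

/-- The coefficient of e_ij in a·e_ij is a_ii, so a_ii is counted once for every j with e_ij in the
algebra. -/
theorem trace_mulLeft (a : UT K n) : LinearMap.trace K (UT K n) (LinearMap.mulLeft K a) =
    ∑ i, (Fintype.card {j : UTIndex n // i.1 ≤ j.1} : K) *
      (a : Matrix (UTIndex n) (UTIndex n) K) i i := by
  classical
  rw [LinearMap.trace_eq_matrix_trace K (Module.Basis.ofEquivFun (entriesEquiv K n)), Matrix.trace]
  have h1 : ∀ p : {p : UTIndex n × UTIndex n // p.1.1 ≤ p.2.1},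
      (LinearMap.toMatrix (Module.Basis.ofEquivFun (entriesEquiv K n))
        (Module.Basis.ofEquivFun (entriesEquiv K n)) (LinearMap.mulLeft K a)).diag p =
      (a : Matrix (UTIndex n) (UTIndex n) K) p.1.1 p.1.1 := by
    intro p
    rw [Matrix.diag_apply, LinearMap.toMatrix_apply, Module.Basis.ofEquivFun_repr_apply,
      Module.Basis.coe_ofEquivFun]
    beta_reduce
    rw [entriesEquiv_symm_single]
    change ((a : Matrix (UTIndex n) (UTIndex n) K) * Matrix.single p.1.1 p.1.2 1 :
      Matrix (UTIndex n) (UTIndex n) K) p.1.1 p.1.2 = _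
    simp
  refine (Finset.sum_congr rfl fun p _ => h1 p).trans ?_
  refine (Fintype.sum_equiv (Equiv.subtypeProdEquivSigmaSubtype
    fun i j : UTIndex n => i.1 ≤ j.1) _
    (fun q => (a : Matrix (UTIndex n) (UTIndex n) K) q.1 q.1) fun _ => rfl).trans ?_
  rw [Fintype.sum_sigma]
  simp

/-- The strictly upper block triangular matrices. -/
def radical (K : Type*) [Field K] {t : ℕ} (n : Fin t → ℕ) : Submodule K (UT K n) where
  carrier := {a | ∀ i j : UTIndex n, i.1 = j.1 → (a : Matrix (UTIndex n) (UTIndex n) K) i j = 0}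
  zero_mem' _ _ _ := rfl
  add_mem' {a b} ha hb i j hij := by
    rw [Subalgebra.coe_add, Matrix.add_apply, ha i j hij, hb i j hij, add_zero]
  smul_mem' c a ha i j hij := by
    rw [Subalgebra.coe_smul, Matrix.smul_apply, ha i j hij, smul_zero]

theorem apply_eq_zero_of_mem_radical {a : UT K n} (ha : a ∈ radical K n) {i j : UTIndex n}
    (h : j.1 ≤ i.1) : (a : Matrix (UTIndex n) (UTIndex n) K) i j = 0 :=
  h.lt_or_eq.elim (apply_eq_zero a) fun h => ha i j h.symm

theorem unit_mem_radical {i j : UTIndex n} (h : i.1 < j.1) :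
    UT.unit K n i j h.le ∈ radical K n := by
  intro p q hpq
  rw [coe_unit]
  refine Matrix.single_apply_of_ne _ _ _ _ _ ?_
  rintro ⟨rfl, rfl⟩
  exact h.ne hpq

/-- This is where the characteristic matters: the multiplicity of a_ii in the trace is positive and,
through j ↦ e_ij, at most the dimension. -/
theorem card_ne_zero (hK : ringChar K = 0 ∨ Module.finrank K (UT K n) < ringChar K)
    (i : UTIndex n) : (Fintype.card {j : UTIndex n // i.1 ≤ j.1} : K) ≠ 0 := by
  have hpos : 0 < Fintype.card {j : UTIndex n // i.1 ≤ j.1} :=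
    Fintype.card_pos_iff.2 ⟨⟨i, le_rfl⟩⟩
  have hle : Fintype.card {j : UTIndex n // i.1 ≤ j.1} ≤ Module.finrank K (UT K n) := by
    rw [finrank_eq]
    exact Fintype.card_le_of_injective
      (fun j => (⟨(i, j.1), j.2⟩ : {p : UTIndex n × UTIndex n // p.1.1 ≤ p.2.1}))
      fun j j' h => Subtype.ext (congrArg (fun p => p.1.2) h)
  rw [Ne, ringChar.spec]
  rcases hK with h | h
  · rw [h, zero_dvd_iff]
    exact hpos.ne'
  · exact fun hd => absurd (Nat.le_of_dvd hpos hd) (by omega)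

theorem mem_radical_iff_trace
    (hK : ringChar K = 0 ∨ Module.finrank K (UT K n) < ringChar K) (a : UT K n) :
    a ∈ radical K n ↔
      ∀ b : UT K n, LinearMap.trace K (UT K n) (LinearMap.mulLeft K (a * b)) = 0 := by
  constructor
  · intro ha b
    rw [trace_mulLeft]
    refine Finset.sum_eq_zero fun i _ => ?_
    rw [Subalgebra.coe_mul, Matrix.mul_apply, Finset.sum_eq_zero, mul_zero]
    intro j _
    rcases le_or_gt j.1 i.1 with h | h
    · rw [apply_eq_zero_of_mem_radical ha h, zero_mul]
    · rw [apply_eq_zero b h, mul_zero]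
  · intro h i j hij
    -- The only possibly non-zero diagonal entry of a·e_ji is the one at i, and it is a_ij.
    have := h (UT.unit K n j i hij.ge)
    rw [trace_mulLeft, Finset.sum_eq_single i] at this
    · rw [Subalgebra.coe_mul, coe_unit, Matrix.mul_single_apply_same, mul_one] at this
      exact (mul_eq_zero.1 this).resolve_left (card_ne_zero hK i)
    · intro p _ hp
      rw [Subalgebra.coe_mul, coe_unit, Matrix.mul_single_apply_of_ne _ _ _ _ _ hp, mul_zero]
    · simp

variable {G : Type*} [Group G] {𝒜 : G → Submodule K (UT K n)}

/-- Over a field of characteristic zero or large enough, the radical of `UT(n₁, …, n_t)` is a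
graded ideal, as the radical of the trace form. -/
theorem proj_mem_radical (h𝒜 : IsGroupGrading 𝒜)
    (hK : ringChar K = 0 ∨ Module.finrank K (UT K n) < ringChar K) {a : UT K n}
    (ha : a ∈ radical K n) (g : G) : h𝒜.isDecomposition.proj g a ∈ radical K n := by
  have h𝒟 := h𝒜.isDecomposition
  rw [mem_radical_iff_trace hK] at ha ⊢
  let τ : UT K n →ₗ[K] K := LinearMap.trace K (UT K n) ∘ₗ LinearMap.mul K (UT K n)
  change ∀ b, τ (h𝒟.proj g a * b) = 0
  refine LinearMap.ext_on_iSup (f := τ ∘ₗ LinearMap.mulLeft K (h𝒟.proj g a)) (f' := 0)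
    h𝒜.iSup_eq_top fun h b hb => ?_
  change τ (h𝒟.proj g a * b) = 0
  -- If gh ≠ 1, the trace vanishes for reasons of degree. If gh = 1, then b pairs to zero with all
  -- components of a except the one of degree g, so the trace for that component equals the trace
  -- for a itself.
  by_cases hgh : g * h = 1
  · have := LinearMap.ext_on_iSup (f := τ ∘ₗ LinearMap.mulRight K b ∘ₗ h𝒟.proj g)
      (f' := τ ∘ₗ LinearMap.mulRight K b) h𝒜.iSup_eq_top (fun k c hc => ?_) a
    · exact this.trans (ha b)
    · change τ (h𝒟.proj g c * b) = τ (c * b)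
      by_cases hk : g = k
      · subst hk
        rw [h𝒟.proj_of_mem hc]
      · rw [h𝒟.proj_of_mem_ne hk hc, zero_mul, map_zero]
        refine (h𝒜.trace_mulLeft (fun e => hk ?_) (h𝒜.mul_mem hc hb)).symm
        exact mul_right_cancel (hgh.trans e.symm)
  · exact h𝒜.trace_mulLeft hgh (h𝒜.mul_mem (h𝒟.proj_mem g a) hb)

end UT

/-! ### Graded modules and the last block column -/

/-- A decomposition of `K^ι ⊗ K^m`, viewed as `ι × m` matrices, that makes it a graded module
over the graded algebra `UT(n₁, …, n_t)` acting by matrix multiplication. -/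
structure IsGradedModule {G K : Type*} [Group G] [Field K] {t : ℕ} {n : Fin t → ℕ} {m : ℕ}
    (𝒜 : G → Submodule K (UT K n)) (𝒰 : G → Submodule K (Matrix (UTIndex n) (Fin m) K)) :
    Prop extends IsDecomposition 𝒰 where
  mul_mem : ∀ {g h : G} {a : UT K n} {x : Matrix (UTIndex n) (Fin m) K}, a ∈ 𝒜 g → x ∈ 𝒰 h →
    (a : Matrix (UTIndex n) (UTIndex n) K) * x ∈ 𝒰 (g * h)

namespace UT

variable {K : Type*} [Field K] {t : ℕ} {n : Fin t → ℕ}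

/-- The inclusion of the last block column into `UT(n₁, …, n_t)`. -/
def lastColumn (K : Type*) [Field K] {t : ℕ} (n : Fin t → ℕ) (l : Fin t) (hl : ∀ k, k ≤ l) :
    Matrix (UTIndex n) (Fin (n l)) K →ₗ[K] UT K n where
  toFun x := ⟨Matrix.of fun i j => if h : j.1 = l then x i (h ▸ j.2) else 0, fun i j hij => by
    rw [Matrix.of_apply, dif_neg]
    rintro h
    exact absurd (hl i.1) (not_le.2 (h ▸ hij))⟩
  map_add' x y := by
    ext i j
    by_cases h : j.1 = l <;> simp [h]
  map_smul' c x := by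
    ext i j
    by_cases h : j.1 = l <;> simp [h]

variable (l : Fin t) (hl : ∀ k, k ≤ l)

theorem lastColumn_apply_same (x : Matrix (UTIndex n) (Fin (n l)) K) (i : UTIndex n)
    (j : Fin (n l)) : (lastColumn K n l hl x : Matrix (UTIndex n) (UTIndex n) K) i ⟨l, j⟩ =
      x i j := by
  simp [lastColumn]

theorem lastColumn_apply_of_ne (x : Matrix (UTIndex n) (Fin (n l)) K) (i : UTIndex n)
    {j : UTIndex n} (hj : j.1 ≠ l) :
    (lastColumn K n l hl x : Matrix (UTIndex n) (UTIndex n) K) i j = 0 := by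
  simp [lastColumn, hj]

theorem lastColumn_injective : Function.Injective (lastColumn K n l hl) := by
  intro x y hxy
  ext i j
  rw [← lastColumn_apply_same l hl x, hxy, lastColumn_apply_same]

theorem lastColumn_mul (a : UT K n) (x : Matrix (UTIndex n) (Fin (n l)) K) :
    lastColumn K n l hl ((a : Matrix (UTIndex n) (UTIndex n) K) * x) =
      a * lastColumn K n l hl x := by
  ext i ⟨k, j⟩
  rw [Subalgebra.coe_mul]
  by_cases hk : k = l
  · subst hk
    rw [lastColumn_apply_same, Matrix.mul_apply, Matrix.mul_apply]
    simp_rw [lastColumn_apply_same]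
  · rw [lastColumn_apply_of_ne l hl _ _ (j := ⟨k, j⟩) hk, Matrix.mul_apply]
    symm
    exact Finset.sum_eq_zero fun p _ => by
      rw [lastColumn_apply_of_ne l hl x p (j := ⟨k, j⟩) hk, mul_zero]

/-- Describing the last block column as the left annihilator of the radical shows that it is graded.
-/
theorem mem_range_lastColumn (hnl : 0 < n l) (a : UT K n) :
    a ∈ LinearMap.range (lastColumn K n l hl) ↔ ∀ b ∈ radical K n, a * b = 0 := by
  constructor
  · rintro ⟨x, rfl⟩ b hb
    ext i j
    rw [Subalgebra.coe_mul, Matrix.mul_apply, Finset.sum_eq_zero]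
    · rfl
    intro p _
    by_cases hp : p.1 = l
    · rw [apply_eq_zero_of_mem_radical hb (hp ▸ hl j.1), mul_zero]
    · rw [lastColumn_apply_of_ne l hl _ _ hp, zero_mul]
  · intro h
    refine ⟨Matrix.of fun i j => (a : Matrix (UTIndex n) (UTIndex n) K) i ⟨l, j⟩, ?_⟩
    ext i ⟨k, j⟩
    by_cases hk : k = l
    · subst hk
      exact lastColumn_apply_same k hl _ i j
    · rw [lastColumn_apply_of_ne l hl _ i (j := ⟨k, j⟩) hk]
      have hlt : (⟨k, j⟩ : UTIndex n).1 < (⟨l, ⟨0, hnl⟩⟩ : UTIndex n).1 :=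
        lt_of_le_of_ne (hl k) hk
      -- Multiplying by this unit moves column (k, j) of a to column (l, 0), so column (k, j) must
      -- vanish.
      have := h _ (unit_mem_radical (K := K) hlt)
      have := congrArg
        (fun b : UT K n => (b : Matrix (UTIndex n) (UTIndex n) K) i ⟨l, ⟨0, hnl⟩⟩) this
      simpa using this.symm

variable {G : Type*} [Group G] {𝒜 : G → Submodule K (UT K n)}

theorem exists_isGradedModule (h𝒜 : IsGroupGrading 𝒜)
    (hK : ringChar K = 0 ∨ Module.finrank K (UT K n) < ringChar K) (ht : 0 < t)
    (hn : ∀ k, 0 < n k) : ∃ m : ℕ, 0 < m ∧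
      ∃ 𝒰 : G → Submodule K (Matrix (UTIndex n) (Fin m) K), IsGradedModule 𝒜 𝒰 := by
  have h𝒟 := h𝒜.isDecomposition
  let l : Fin t := ⟨t - 1, by omega⟩
  have hl : ∀ k, k ≤ l := fun k => Fin.le_def.2 (by have := k.2; simp only [l]; omega)
  refine ⟨n l, hn l, fun g => (𝒜 g).comap (lastColumn K n l hl),
    ⟨h𝒟.comap (lastColumn_injective l hl) fun g x => ?_, fun {g h a x} ha hx => ?_⟩⟩
  · rw [mem_range_lastColumn l hl (hn l)]
    intro b hb
    obtain ⟨S, hS⟩ := h𝒟.exists_support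
    rw [← h𝒟.sum_proj hS b, Finset.mul_sum]
    refine Finset.sum_eq_zero fun h _ => ?_
    -- If b_h is a homogeneous component of b, then x_g b_h is the component of degree gh of x b_h,
    -- which is zero because b_h lies in the radical.
    have hf : ∀ k, ∀ c ∈ 𝒜 k, LinearMap.mulRight K (h𝒟.proj h b) c ∈ 𝒜 (k * h) :=
      fun k c hc => h𝒜.mul_mem hc (h𝒟.proj_mem h b)
    have := h𝒟.proj_map h𝒟 (mul_left_injective h) hf g (lastColumn K n l hl x)
    rw [LinearMap.mulRight_apply, LinearMap.mulRight_apply,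
      (mem_range_lastColumn l hl (hn l) _).1 ⟨x, rfl⟩ _ (proj_mem_radical h𝒜 hK hb h),
      map_zero] at this
    exact this.symm
  · rw [Submodule.mem_comap, lastColumn_mul]
    exact h𝒜.mul_mem ha hx

end UT

/-! ### The graded endomorphism algebra -/

/-- A linear endomorphism of `K^ι ⊗ K^m` that commutes with the action of `UT(n₁, …, n_t)` is
the right multiplication by a matrix. -/
theorem UT.eq_mul_of_commute {K : Type*} [Field K] {t : ℕ} {n : Fin t → ℕ} {m : ℕ}
    {p : UTIndex n} (hp : ∀ i : UTIndex n, i.1 ≤ p.1)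
    (f : Matrix (UTIndex n) (Fin m) K →ₗ[K] Matrix (UTIndex n) (Fin m) K)
    (hf : ∀ (a : UT K n) x, f ((a : Matrix (UTIndex n) (UTIndex n) K) * x) =
      (a : Matrix (UTIndex n) (UTIndex n) K) * f x) (x : Matrix (UTIndex n) (Fin m) K) :
    f x = x * (Matrix.of fun c c' => f (Matrix.single p c 1) p c') := by
  set δ : Matrix (Fin m) (Fin m) K := Matrix.of fun c c' => f (Matrix.single p c 1) p c' with hδ
  have : f = mulRightLinearMap (UTIndex n) K δ := by
    refine Matrix.ext_linearMap K fun i c => LinearMap.ext_ring ?_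
    change f (Matrix.single i c 1) = (Matrix.single i c 1 : Matrix (UTIndex n) (Fin m) K) * δ
    -- As p lies in the last block, e_ip belongs to the algebra for every i; thus f is determined by
    -- its values on the matrices supported in row p.
    have h1 : (Matrix.single i c 1 : Matrix (UTIndex n) (Fin m) K) =
        (UT.unit K n i p (hp i) : Matrix (UTIndex n) (UTIndex n) K) *
          (Matrix.single p c 1 : Matrix (UTIndex n) (Fin m) K) := by
      simp
    rw [h1, hf, ← h1, UT.coe_unit]
    ext i' c'
    by_cases hi : i' = i
    · subst hi
      simp [hδ]
    · rw [Matrix.single_mul_apply_of_ne _ _ _ _ _ hi, Matrix.single_mul_apply_of_ne _ _ _ _ _ hi]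
  exact congrArg (fun F : Matrix (UTIndex n) (Fin m) K →ₗ[K] Matrix (UTIndex n) (Fin m) K => F x)
    this

/-- The matrices of size `m` whose right multiplication shifts the degrees of `𝒰` by `g`. -/
def rightComponent {G K ι : Type*} [Group G] [Field K] {m : ℕ}
    (𝒰 : G → Submodule K (Matrix ι (Fin m) K)) (g : G) :
    Submodule K (Matrix (Fin m) (Fin m) K) where
  carrier := {d | ∀ h, ∀ x ∈ 𝒰 h, x * d ∈ 𝒰 (h * g)}
  zero_mem' h x _ := by
    rw [Matrix.mul_zero]
    exact zero_mem _
  add_mem' {d e} hd he h x hx := by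
    rw [Matrix.mul_add]
    exact add_mem (hd h x hx) (he h x hx)
  smul_mem' c d hd h x hx := by
    rw [Matrix.mul_smul]
    exact Submodule.smul_mem _ _ (hd h x hx)

theorem mul_mem_of_mem_rightComponent {G K ι : Type*} [Group G] [Field K] {m : ℕ}
    {𝒰 : G → Submodule K (Matrix ι (Fin m) K)} {g h : G} {d : Matrix (Fin m) (Fin m) K}
    (hd : d ∈ rightComponent 𝒰 g) {x : Matrix ι (Fin m) K} (hx : x ∈ 𝒰 h) : x * d ∈ 𝒰 (h * g) :=
  hd h x hx

theorem IsDecomposition.proj_mul_right {G K ι : Type*} [Group G] [Field K] {m : ℕ}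
    {𝒰 : G → Submodule K (Matrix ι (Fin m) K)} (h𝒰 : IsDecomposition 𝒰) {g : G}
    {d : Matrix (Fin m) (Fin m) K} (hd : d ∈ rightComponent 𝒰 g) (h : G)
    (x : Matrix ι (Fin m) K) : h𝒰.proj (h * g) (x * d) = h𝒰.proj h x * d :=
  h𝒰.proj_map h𝒰 (f := mulRightLinearMap ι K d) (mul_left_injective g) hd h x

namespace IsGradedModule

variable {G K : Type*} [Group G] [Field K] {t : ℕ} {n : Fin t → ℕ} {m : ℕ}
  {𝒜 : G → Submodule K (UT K n)} {𝒰 : G → Submodule K (Matrix (UTIndex n) (Fin m) K)}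

theorem proj_mul_left (h𝒰 : IsGradedModule 𝒜 𝒰) {g : G} {a : UT K n} (ha : a ∈ 𝒜 g) (h : G)
    (x : Matrix (UTIndex n) (Fin m) K) :
    h𝒰.toIsDecomposition.proj (g * h) ((a : Matrix (UTIndex n) (UTIndex n) K) * x) =
      (a : Matrix (UTIndex n) (UTIndex n) K) * h𝒰.toIsDecomposition.proj h x :=
  h𝒰.toIsDecomposition.proj_map h𝒰.toIsDecomposition
    (f := mulLeftLinearMap (Fin m) K (a : Matrix (UTIndex n) (UTIndex n) K))
    (mul_right_injective g) (fun _ _ hx => h𝒰.mul_mem ha hx) h x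

/-- The endomorphism algebra of a graded module of the form `K^ι ⊗ K^m` is graded. -/
theorem isGroupGrading_rightComponent (h𝒜 : IsGroupGrading 𝒜) (h𝒰 : IsGradedModule 𝒜 𝒰)
    {p : UTIndex n} (hp : ∀ i : UTIndex n, i.1 ≤ p.1) : IsGroupGrading (rightComponent 𝒰) := by
  classical
  have hD := h𝒰.toIsDecomposition
  obtain ⟨S, hS⟩ := hD.exists_support
  -- The part of degree g of right multiplication by d, sending x of degree h to the component of xd
  -- of degree hg. It commutes with the algebra, so it is right multiplication by a matrix, called
  -- `δ g d` below.
  let f (g : G) (d : Matrix (Fin m) (Fin m) K) :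
      Matrix (UTIndex n) (Fin m) K →ₗ[K] Matrix (UTIndex n) (Fin m) K :=
    ∑ h ∈ S, hD.proj (h * g) ∘ₗ mulRightLinearMap (UTIndex n) K d ∘ₗ hD.proj h
  have f_apply : ∀ g d h, ∀ x ∈ 𝒰 h, f g d x = hD.proj (h * g) (x * d) := by
    intro g d h x hx
    simp only [f, LinearMap.sum_apply, LinearMap.comp_apply]
    by_cases hh : h ∈ S
    · rw [Finset.sum_eq_single_of_mem h hh, hD.proj_of_mem hx]
      · rfl
      · intro k _ hk
        rw [hD.proj_of_mem_ne hk hx, map_zero, map_zero]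
    · have : x = 0 := by simpa [hS h hh] using hx
      simp [this]
  have f_comm : ∀ g d (a : UT K n) x, f g d ((a : Matrix (UTIndex n) (UTIndex n) K) * x) =
      (a : Matrix (UTIndex n) (UTIndex n) K) * f g d x := by
    intro g d a x
    let ρ (y : Matrix (UTIndex n) (Fin m) K) : UT K n →ₗ[K] Matrix (UTIndex n) (Fin m) K :=
      (mulLinearMap K).flip y ∘ₗ (UT K n).val.toLinearMap
    refine LinearMap.ext_on_iSup (f := f g d ∘ₗ ρ x) (f' := ρ (f g d x)) h𝒜.iSup_eq_top ?_ a
    intro k b hb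
    change f g d ((b : Matrix (UTIndex n) (UTIndex n) K) * x) =
      (b : Matrix (UTIndex n) (UTIndex n) K) * f g d x
    let lb := mulLeftLinearMap (Fin m) K (b : Matrix (UTIndex n) (UTIndex n) K)
    refine LinearMap.ext_on_iSup (f := f g d ∘ₗ lb) (f' := lb ∘ₗ f g d) hD.iSup_eq_top ?_ x
    intro h y hy
    change f g d ((b : Matrix (UTIndex n) (UTIndex n) K) * y) =
      (b : Matrix (UTIndex n) (UTIndex n) K) * f g d y
    rw [f_apply g d _ _ (h𝒰.mul_mem hb hy), f_apply g d h y hy, mul_assoc k, Matrix.mul_assoc,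
      h𝒰.proj_mul_left hb]
  let δ (g : G) : Matrix (Fin m) (Fin m) K →ₗ[K] Matrix (Fin m) (Fin m) K :=
    { toFun := fun d => Matrix.of fun c c' => f g d (Matrix.single p c 1) p c'
      map_add' := fun d e => by
        ext c c'
        simp [f, Matrix.mul_add, Finset.sum_add_distrib, Matrix.sum_apply]
      map_smul' := fun r d => by
        ext c c'
        simp [f, Finset.mul_sum, Matrix.sum_apply] }
  have mul_δ : ∀ g d x, x * δ g d = f g d x := fun g d x =>
    (UT.eq_mul_of_commute hp (f g d) (f_comm g d) x).symm
  have mul_ext : ∀ d e : Matrix (Fin m) (Fin m) K,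
      (∀ h, ∀ x ∈ 𝒰 h, x * d = x * e) → d = e := by
    intro d e hde
    ext c c'
    have := LinearMap.ext_on_iSup (f := mulRightLinearMap (UTIndex n) K d)
      (f' := mulRightLinearMap (UTIndex n) K e) hD.iSup_eq_top hde (Matrix.single p c 1)
    have := congrFun (congrFun this p) c'
    simpa using this
  have δ_mem : ∀ g d, δ g d ∈ rightComponent 𝒰 g := by
    intro g d h x hx
    rw [mul_δ, f_apply g d h x hx]
    exact hD.proj_mem _ _
  refine ⟨iSupIndep_of_projections δ (fun g d hd => ?_) fun g h hgh d hd => ?_, ?_, ?_⟩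
  · refine mul_ext _ _ fun h x hx => ?_
    rw [mul_δ, f_apply g d h x hx, hD.proj_of_mem (hd h x hx)]
  · refine mul_ext _ _ fun k x hx => ?_
    rw [mul_δ, f_apply g d k x hx, hD.proj_of_mem_ne (fun e => hgh (mul_left_cancel e)) (hd k x hx),
      Matrix.mul_zero]
  · rw [eq_top_iff]
    intro d _
    -- Only quotients h⁻¹k of degrees in the support can carry the component of degree h to that of
    -- degree k.
    let T : Finset G := (S ×ˢ S).image fun q => q.1⁻¹ * q.2
    have : d = ∑ g ∈ T, δ g d := by
      refine mul_ext _ _ fun h x hx => ?_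
      rw [Matrix.mul_sum]
      by_cases hh : h ∈ S
      · have hT : ∀ k, k ∉ T.image (h * ·) → 𝒰 k = ⊥ := by
          intro k hk
          refine hS k fun hkS => hk ?_
          exact Finset.mem_image.2 ⟨h⁻¹ * k,
            Finset.mem_image.2 ⟨(h, k), Finset.mem_product.2 ⟨hh, hkS⟩, rfl⟩,
            mul_inv_cancel_left h k⟩
        rw [← hD.sum_proj hT (x * d), Finset.sum_image fun _ _ _ _ e => mul_left_cancel e]
        refine Finset.sum_congr rfl fun g _ => ?_
        rw [mul_δ, f_apply g d h x hx]
      · have : x = 0 := by simpa [hS h hh] using hx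
        simp [this]
    rw [this]
    exact Submodule.sum_mem _ fun g _ => Submodule.mem_iSup_of_mem g (δ_mem g d)
  · intro g h d e hd he k x hx
    rw [← Matrix.mul_assoc, ← mul_assoc]
    exact he _ _ (hd k x hx)

/-- A graded module `K^ι ⊗ K^m` of minimal dimension has a graded division algebra of
endomorphisms. -/
theorem isDivisionGrading_rightComponent (h𝒜 : IsGroupGrading 𝒜) (h𝒰 : IsGradedModule 𝒜 𝒰)
    {p : UTIndex n} (hp : ∀ i : UTIndex n, i.1 ≤ p.1)
    (hmin : ∀ r : ℕ, 0 < r → ∀ 𝒱 : G → Submodule K (Matrix (UTIndex n) (Fin r) K),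
      IsGradedModule 𝒜 𝒱 → m ≤ r) : IsDivisionGrading (rightComponent 𝒰) := by
  refine ⟨isGroupGrading_rightComponent h𝒜 h𝒰 hp, fun {g d} hd hd0 => ?_⟩
  have hD := h𝒰.toIsDecomposition
  -- R is the row space of d. With a basis of R as the rows of `P`, right multiplication by `P`
  -- identifies the matrices of width dim R with the image of right multiplication by d.
  let R := LinearMap.range d.vecMulLinear
  let b := Module.finBasis K R
  let P : Matrix (Fin (Module.finrank K R)) (Fin m) K := Matrix.of fun i => (b i : Fin m → K)
  have row_P : ∀ (X : Matrix (UTIndex n) (Fin (Module.finrank K R)) K) i,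
      (X * P) i = ((∑ j, X i j • b j : R) : Fin m → K) := by
    intro X i
    ext c
    simp [Matrix.mul_apply, P]
  let f := mulRightLinearMap (UTIndex n) K P
  have f_inj : Function.Injective f := by
    rw [injective_iff_map_eq_zero]
    intro X hX
    ext i j
    have h0 : ∑ j, X i j • b j = 0 := by
      refine Subtype.ext ((row_P X i).symm.trans ?_)
      exact congrFun hX i
    exact Fintype.linearIndependent_iff.1 b.linearIndependent _ h0 j
  have f_range : ∀ Y : Matrix (UTIndex n) (Fin m) K,
      Y ∈ LinearMap.range f ↔ ∃ X : Matrix (UTIndex n) (Fin m) K, X * d = Y := by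
    intro Y
    constructor
    · rintro ⟨X, rfl⟩
      have : ∀ i, ∃ v, d.vecMulLinear v = (X * P) i := fun i => by
        rw [row_P X i]
        exact (∑ j, X i j • b j : R).2
      choose v hv using this
      exact ⟨Matrix.of v, funext fun i => hv i⟩
    · rintro ⟨X, rfl⟩
      refine ⟨Matrix.of fun i => b.repr ⟨d.vecMulLinear (X i), ⟨X i, rfl⟩⟩, funext fun i => ?_⟩
      refine (row_P _ i).trans ?_
      have := b.sum_repr ⟨d.vecMulLinear (X i), ⟨X i, rfl⟩⟩
      exact congrArg Subtype.val this
  have hmod : IsGradedModule 𝒜 fun g => (𝒰 g).comap f := by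
    refine ⟨hD.comap f_inj fun k X => ?_, fun {k h a X} ha hX => ?_⟩
    -- The image of a homogeneous map is graded: the component of Yd of degree k is the component of
    -- Y of degree kg⁻¹, times d.
    · obtain ⟨Y, hY⟩ := (f_range (f X)).1 ⟨X, rfl⟩
      refine (f_range _).2 ⟨hD.proj (k * g⁻¹) Y, ?_⟩
      rw [← hY, ← hD.proj_mul_right hd, inv_mul_cancel_right]
    · change (a : Matrix (UTIndex n) (UTIndex n) K) * X * P ∈ 𝒰 (k * h)
      rw [Matrix.mul_assoc]
      exact h𝒰.mul_mem ha hX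
  have hR : 0 < Module.finrank K R := by
    rw [Module.finrank_pos_iff_exists_ne_zero]
    by_contra! hall
    refine hd0 (Matrix.ext_of_single_vecMul fun i => ?_)
    rw [Matrix.vecMul_zero]
    exact congrArg Subtype.val (hall ⟨d.vecMulLinear (Pi.single i 1), ⟨_, rfl⟩⟩)
  have hle := hmin _ hR _ hmod
  have htop : R = ⊤ := by
    refine Submodule.eq_top_of_finrank_eq (le_antisymm (Submodule.finrank_le R) ?_)
    rwa [Module.finrank_fin_fun]
  exact Matrix.vecMul_surjective_iff_isUnit.1 (LinearMap.range_eq_top.1 htop)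

end IsGradedModule

/-! ### The flag of block submodules -/

/-- The matrices whose rows in the blocks from `k` on vanish. -/
def blockFlag (K : Type*) [Field K] {t : ℕ} (n : Fin t → ℕ) (m k : ℕ) :
    Submodule K (Matrix (UTIndex n) (Fin m) K) where
  carrier := {x | ∀ i c, k ≤ (i.1 : ℕ) → x i c = 0}
  zero_mem' _ _ _ := rfl
  add_mem' {x y} hx hy i c h := by
    rw [Matrix.add_apply, hx i c h, hy i c h, add_zero]
  smul_mem' r x hx i c h := by
    rw [Matrix.smul_apply, hx i c h, smul_zero]

section blockFlag

variable {K : Type*} [Field K] {t : ℕ} {n : Fin t → ℕ} {m : ℕ}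

theorem blockFlag_mono {k k' : ℕ} (h : k ≤ k') : blockFlag K n m k ≤ blockFlag K n m k' :=
  fun _ hx i c hi => hx i c (h.trans hi)

theorem blockFlag_zero : blockFlag K n m 0 = ⊥ :=
  (Submodule.eq_bot_iff _).2 fun _ hx => Matrix.ext fun i c => hx i c (Nat.zero_le _)

theorem mem_blockFlag_of_le {k : ℕ} (hk : t ≤ k) (x : Matrix (UTIndex n) (Fin m) K) :
    x ∈ blockFlag K n m k :=
  fun i _ hi => absurd (hk.trans hi) (not_le.2 i.1.2)

theorem mul_mem_blockFlag {k : ℕ} {x : Matrix (UTIndex n) (Fin m) K} (hx : x ∈ blockFlag K n m k)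
    (d : Matrix (Fin m) (Fin m) K) : x * d ∈ blockFlag K n m k := fun i c hi => by
  rw [Matrix.mul_apply]
  exact Finset.sum_eq_zero fun j _ => by rw [hx i j hi, zero_mul]

/-- The flag is recovered from the radical alone, layer by layer; this carries gradedness from the
radical to the flag. -/
theorem mem_blockFlag_succ_iff (hn : ∀ k, 0 < n k) {k : ℕ} {x : Matrix (UTIndex n) (Fin m) K} :
    x ∈ blockFlag K n m (k + 1) ↔ ∀ b ∈ UT.radical K n,
      (b : Matrix (UTIndex n) (UTIndex n) K) * x ∈ blockFlag K n m k := by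
  constructor
  · intro hx b hb i c hi
    rw [Matrix.mul_apply]
    refine Finset.sum_eq_zero fun j _ => ?_
    rcases le_or_gt j.1 i.1 with h | h
    · rw [UT.apply_eq_zero_of_mem_radical hb h, zero_mul]
    · rw [hx j c (hi.trans_lt (Fin.lt_def.1 h)), mul_zero]
  · intro h i c hi
    have hkt : k < t := lt_of_lt_of_le (Nat.lt_of_succ_le hi) i.1.2.le
    -- Row j of e_ji x is row i of x, and j lies in block k, where the rows of elements of the k-th
    -- step vanish.
    let j : UTIndex n := ⟨⟨k, hkt⟩, ⟨0, hn _⟩⟩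
    have hji : j.1 < i.1 := Fin.lt_def.2 hi
    have := h _ (UT.unit_mem_radical hji) j c le_rfl
    rwa [UT.coe_unit, Matrix.single_mul_apply_same, one_mul] at this

theorem IsGradedModule.proj_mem_blockFlag {G : Type*} [Group G] {𝒜 : G → Submodule K (UT K n)}
    (h𝒜 : IsGroupGrading 𝒜) (hK : ringChar K = 0 ∨ Module.finrank K (UT K n) < ringChar K)
    (hn : ∀ k, 0 < n k) {𝒰 : G → Submodule K (Matrix (UTIndex n) (Fin m) K)}
    (h𝒰 : IsGradedModule 𝒜 𝒰) (k : ℕ) {x : Matrix (UTIndex n) (Fin m) K}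
    (hx : x ∈ blockFlag K n m k) (g : G) :
    h𝒰.toIsDecomposition.proj g x ∈ blockFlag K n m k := by
  have h𝒟 := h𝒜.isDecomposition
  induction k generalizing x g with
  | zero =>
    rw [blockFlag_zero, Submodule.mem_bot] at hx ⊢
    rw [hx, map_zero]
  | succ k ih =>
    rw [mem_blockFlag_succ_iff hn] at hx ⊢
    intro b hb
    obtain ⟨S, hS⟩ := h𝒟.exists_support
    rw [← h𝒟.sum_proj hS b, AddSubmonoidClass.coe_finsetSum, Matrix.sum_mul]
    refine Submodule.sum_mem _ fun h _ => ?_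
    rw [← h𝒰.proj_mul_left (h𝒟.proj_mem h b)]
    exact ih (hx _ (UT.proj_mem_radical h𝒜 hK hb h)) _

end blockFlag

/-! ### Homogeneous bases over a graded division algebra -/

section HomogeneousBasis

variable {G K ι : Type*} [Group G] [Field K] {m : ℕ}
  {𝒰 : G → Submodule K (Matrix ι (Fin m) K)}

theorem IsDecomposition.proj_mul_of_mem (h𝒰 : IsDecomposition 𝒰)
    (h𝒟 : IsDecomposition (rightComponent 𝒰)) {h : G} {w : Matrix ι (Fin m) K} (hw : w ∈ 𝒰 h)
    (g : G) (d : Matrix (Fin m) (Fin m) K) :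
    h𝒰.proj (h * g) (w * d) = w * h𝒟.proj g d :=
  h𝒟.proj_map h𝒰 (f := mulLeftLinearMap (Fin m) K w) (mul_right_injective h)
    (fun _ _ hd => hd h w hw) g d

/-- A homogeneous vector outside of a graded submodule generates a free module that meets it
trivially. -/
theorem eq_zero_of_mul_mem (h𝒰 : IsDecomposition 𝒰)
    (h𝒟 : IsDivisionGrading (rightComponent 𝒰)) {Z : Submodule K (Matrix ι (Fin m) K)}
    (hZ : ∀ x ∈ Z, ∀ d : Matrix (Fin m) (Fin m) K, x * d ∈ Z)
    (hZ' : ∀ x ∈ Z, ∀ g, h𝒰.proj g x ∈ Z) {h : G} {w : Matrix ι (Fin m) K} (hw : w ∈ 𝒰 h)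
    (hwZ : w ∉ Z) {d : Matrix (Fin m) (Fin m) K} (hd : w * d ∈ Z) : d = 0 := by
  have hD := h𝒟.toIsGroupGrading.isDecomposition
  -- Since w is homogeneous, w d_g is a component of wd and lies in Z. A non-zero d_g is invertible,
  -- which would put w in Z.
  refine hD.eq_zero_of_proj fun g => ?_
  by_contra hg
  obtain ⟨e, he⟩ := h𝒟.isUnit (hD.proj_mem g d) hg
  refine hwZ ?_
  have h1 : w * (e : Matrix (Fin m) (Fin m) K) ∈ Z := by
    rw [he, ← h𝒰.proj_mul_of_mem hD hw]
    exact hZ' _ hd _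
  have h2 := hZ _ h1 (e⁻¹ : (Matrix (Fin m) (Fin m) K)ˣ)
  rwa [Matrix.mul_assoc, Units.mul_inv, Matrix.mul_one] at h2

/-- Graded submodules of a graded right module over a graded division algebra have complements
with a homogeneous basis. -/
theorem exists_homogeneous_basis [Finite ι] (h𝒰 : IsDecomposition 𝒰)
    (h𝒟 : IsDivisionGrading (rightComponent 𝒰)) {W : Submodule K (Matrix ι (Fin m) K)}
    (hW : ∀ x ∈ W, ∀ d : Matrix (Fin m) (Fin m) K, x * d ∈ W)
    (hW' : ∀ x ∈ W, ∀ g, h𝒰.proj g x ∈ W) (Z : Submodule K (Matrix ι (Fin m) K))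
    (hZ : ∀ x ∈ Z, ∀ d : Matrix (Fin m) (Fin m) K, x * d ∈ Z)
    (hZ' : ∀ x ∈ Z, ∀ g, h𝒰.proj g x ∈ Z) (hZW : Z ≤ W) :
    ∃ (r : ℕ) (u : Fin r → Matrix ι (Fin m) K) (γ : Fin r → G),
      (∀ i, u i ∈ W) ∧ (∀ i, u i ∈ 𝒰 (γ i)) ∧
      (∀ w ∈ W, ∃ d : Fin r → Matrix (Fin m) (Fin m) K, w - ∑ i, u i * d i ∈ Z) ∧
      ∀ d : Fin r → Matrix (Fin m) (Fin m) K, ∑ i, u i * d i ∈ Z → d = 0 := by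
  have hD := h𝒟.toIsGroupGrading.isDecomposition
  -- The submodule Z grows towards W: a homogeneous w of W outside Z is adjoined, and the induction
  -- hypothesis for Z + wD supplies the rest of the basis.
  induction Z using WellFoundedGT.induction with
  | ind Z ih =>
  by_cases hWZ : W ≤ Z
  · refine ⟨0, Fin.elim0, Fin.elim0, fun i => i.elim0, fun i => i.elim0, fun w hw =>
      ⟨Fin.elim0, ?_⟩, fun d _ => Subsingleton.elim _ _⟩
    simpa using hWZ hw
  obtain ⟨x, hxW, hxZ⟩ := SetLike.not_le_iff_exists.1 hWZ
  obtain ⟨h, hh⟩ : ∃ h, h𝒰.proj h x ∉ Z := by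
    by_contra! hall
    exact hxZ (h𝒰.mem_of_proj hall)
  set w := h𝒰.proj h x with hw_def
  have hw : w ∈ 𝒰 h := h𝒰.proj_mem h x
  have hwW : w ∈ W := hW' x hxW h
  have mem_sup : ∀ y, y ∈ Z ⊔ LinearMap.range (mulLeftLinearMap (Fin m) K w) ↔
      ∃ z ∈ Z, ∃ d : Matrix (Fin m) (Fin m) K, z + w * d = y := by
    intro y
    rw [Submodule.mem_sup]
    constructor
    · rintro ⟨z, hz, _, ⟨d, rfl⟩, rfl⟩
      exact ⟨z, hz, d, rfl⟩
    · rintro ⟨z, hz, d, rfl⟩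
      exact ⟨z, hz, _, ⟨d, rfl⟩, rfl⟩
  have hlt : Z < Z ⊔ LinearMap.range (mulLeftLinearMap (Fin m) K w) :=
    lt_of_le_of_ne le_sup_left fun e => hh <| by
      rw [e, mem_sup]
      exact ⟨0, Z.zero_mem, 1, by rw [zero_add, Matrix.mul_one]⟩
  have hZ1 : ∀ y ∈ Z ⊔ LinearMap.range (mulLeftLinearMap (Fin m) K w),
      ∀ d : Matrix (Fin m) (Fin m) K,
        y * d ∈ Z ⊔ LinearMap.range (mulLeftLinearMap (Fin m) K w) := by
    intro y hy d
    obtain ⟨z, hz, e, rfl⟩ := (mem_sup y).1 hy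
    exact (mem_sup _).2 ⟨z * d, hZ z hz d, e * d, by rw [Matrix.add_mul, Matrix.mul_assoc]⟩
  have hZ2 : ∀ y ∈ Z ⊔ LinearMap.range (mulLeftLinearMap (Fin m) K w),
      ∀ g, h𝒰.proj g y ∈ Z ⊔ LinearMap.range (mulLeftLinearMap (Fin m) K w) := by
    intro y hy g
    obtain ⟨z, hz, e, rfl⟩ := (mem_sup y).1 hy
    refine (mem_sup _).2 ⟨_, hZ' z hz g, hD.proj (h⁻¹ * g) e, ?_⟩
    rw [map_add, ← h𝒰.proj_mul_of_mem hD hw, mul_inv_cancel_left]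
  have hZ3 : Z ⊔ LinearMap.range (mulLeftLinearMap (Fin m) K w) ≤ W := by
    refine sup_le hZW ?_
    rintro _ ⟨d, rfl⟩
    exact hW w hwW d
  obtain ⟨r, u, γ, h1, h2, h3, h4⟩ := ih _ hlt hZ1 hZ2 hZ3
  refine ⟨r + 1, Fin.cons w u, Fin.cons h γ, Fin.cases hwW h1, Fin.cases hw h2, fun y hy => ?_,
    fun d hd => ?_⟩
  · obtain ⟨d, hd⟩ := h3 y hy
    obtain ⟨z, hz, e, he⟩ := (mem_sup _).1 hd
    refine ⟨Fin.cons e d, ?_⟩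
    simp only [Fin.sum_univ_succ, Fin.cons_zero, Fin.cons_succ]
    convert hz using 1
    rw [add_comm (w * e), ← sub_sub, ← he, add_sub_cancel_right]
  · simp only [Fin.sum_univ_succ, Fin.cons_zero, Fin.cons_succ] at hd
    -- Modulo Z + wD the term in w disappears, so the other coefficients vanish first.
    have hd' : (fun i : Fin r => d i.succ) = 0 := h4 _ <| (mem_sup _).2
      ⟨_, hd, -d 0, by rw [Matrix.mul_neg]; abel⟩
    have hd0 : ∀ i : Fin r, d i.succ = 0 := congrFun hd'
    simp only [hd0, Matrix.mul_zero, Finset.sum_const_zero, add_zero] at hd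
    exact funext (Fin.cases (eq_zero_of_mul_mem h𝒰 h𝒟 hZ hZ' hw hh hd) hd0)

end HomogeneousBasis

/-- Homogeneous bases of the successive quotients of the flag are lifted and concatenated. The
integer n'_k is the rank over D of the k-th quotient. -/
theorem IsGradedModule.exists_adapted_basis {G K : Type*} [Group G] [Field K] {t : ℕ}
    {n : Fin t → ℕ} {m : ℕ} {𝒜 : G → Submodule K (UT K n)} (h𝒜 : IsGroupGrading 𝒜)
    (hK : ringChar K = 0 ∨ Module.finrank K (UT K n) < ringChar K) (hn : ∀ k, 0 < n k)
    {𝒰 : G → Submodule K (Matrix (UTIndex n) (Fin m) K)} (h𝒰 : IsGradedModule 𝒜 𝒰)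
    (h𝒟 : IsDivisionGrading (rightComponent 𝒰)) (hm : 0 < m) :
    ∃ n' : Fin t → ℕ, (∀ k, 0 < n' k) ∧
      ∃ (u : UTIndex n' → Matrix (UTIndex n) (Fin m) K) (γ : UTIndex n' → G),
        (∀ i, u i ∈ blockFlag K n m (i.1 + 1)) ∧ (∀ i, u i ∈ 𝒰 (γ i)) ∧
        (∀ k, ∀ w ∈ blockFlag K n m k, ∃ d : UTIndex n' → Matrix (Fin m) (Fin m) K,
          (∀ i, k ≤ (i.1 : ℕ) → d i = 0) ∧ ∑ i, u i * d i = w) ∧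
        ∀ d : UTIndex n' → Matrix (Fin m) (Fin m) K, ∑ i, u i * d i = 0 → d = 0 := by
  have key := fun k : Fin t => exists_homogeneous_basis h𝒰.toIsDecomposition h𝒟
    (W := blockFlag K n m (k + 1)) (fun _ hx d => mul_mem_blockFlag hx d)
    (fun _ hx g => h𝒰.proj_mem_blockFlag h𝒜 hK hn _ hx g) (blockFlag K n m k)
    (fun _ hx d => mul_mem_blockFlag hx d)
    (fun _ hx g => h𝒰.proj_mem_blockFlag h𝒜 hK hn _ hx g) (blockFlag_mono (Nat.le_succ _))
  choose n' u γ hu hγ hspan hind using key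
  refine ⟨n', fun k => ?_, fun i => u i.1 i.2, fun i => γ i.1 i.2, fun i => hu i.1 i.2,
    fun i => hγ i.1 i.2, fun k => ?_, ?_⟩
  · by_contra h0
    have : IsEmpty (Fin (n' k)) := by
      rw [Nat.eq_zero_of_not_pos h0]
      infer_instance
    -- A witness that the k-th quotient is non-zero.
    let x : Matrix (UTIndex n) (Fin m) K := Matrix.single ⟨k, ⟨0, hn k⟩⟩ ⟨0, hm⟩ 1
    have hx : x ∈ blockFlag K n m (k + 1) := by
      intro i c hi
      refine Matrix.single_apply_of_ne _ _ _ _ _ ?_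
      rintro ⟨rfl, -⟩
      exact absurd hi (Nat.not_succ_le_self _)
    obtain ⟨d, hd⟩ := hspan k x hx
    rw [Finset.univ_eq_empty, Finset.sum_empty, sub_zero] at hd
    have := hd ⟨k, ⟨0, hn k⟩⟩ ⟨0, hm⟩ le_rfl
    simp [x] at this
  · induction k with
    | zero =>
      intro w hw
      rw [blockFlag_zero, Submodule.mem_bot] at hw
      exact ⟨0, fun _ _ => rfl, by simp [hw]⟩
    | succ k ih =>
      intro w hw
      by_cases hk : k < t
      · obtain ⟨d, hd⟩ := hspan ⟨k, hk⟩ w hw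
        obtain ⟨e, he, hsum⟩ := ih _ hd
        let D : ∀ l : Fin t, Fin (n' l) → Matrix (Fin m) (Fin m) K :=
          Function.update (fun l => 0) ⟨k, hk⟩ d
        have hD : ∑ i : UTIndex n', u i.1 i.2 * D i.1 i.2 = ∑ j, u ⟨k, hk⟩ j * d j := by
          rw [Fintype.sum_sigma, Finset.sum_eq_single ⟨k, hk⟩]
          · simp [D]
          · intro l _ hl
            simp [D, Function.update_of_ne hl]
          · simp
        refine ⟨fun i => e i + D i.1 i.2, fun i hi => ?_, ?_⟩
        · have hne : i.1 ≠ ⟨k, hk⟩ := fun h => by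
            rw [h] at hi
            exact absurd hi (Nat.not_succ_le_self _)
          simp only [D, Function.update_of_ne hne]
          rw [he i (Nat.le_of_succ_le hi)]
          simp
        · simp only [Matrix.mul_add, Finset.sum_add_distrib]
          rw [hD, hsum, sub_add_cancel]
      · obtain ⟨d, hd, hsum⟩ := ih w (mem_blockFlag_of_le (not_lt.1 hk) w)
        exact ⟨d, fun i hi => hd i (Nat.le_of_succ_le hi), hsum⟩
  · intro d hd
    -- The blocks are peeled off from the top: if all coefficients above block k vanish, the terms
    -- of block k sum to an element of the k-th step of the flag, so independence in the quotient
    -- applies.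
    have main : ∀ k : ℕ, (∀ i : UTIndex n', k ≤ (i.1 : ℕ) → d i = 0) → d = 0 := by
      intro k
      induction k with
      | zero => exact fun h => funext fun i => h i (Nat.zero_le _)
      | succ k ih =>
        intro h
        refine ih fun i hi => ?_
        rcases hi.lt_or_eq with hi | hi
        · exact h i hi
        rw [Fintype.sum_sigma, ← Finset.add_sum_erase _ _ (Finset.mem_univ i.1)] at hd
        have hrest : ∑ l ∈ Finset.univ.erase i.1, ∑ j, u l j * d ⟨l, j⟩ ∈ blockFlag K n m i.1 := by
          refine Submodule.sum_mem _ fun l hl => Submodule.sum_mem _ fun j _ => ?_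
          rcases lt_or_gt_of_ne (Finset.ne_of_mem_erase hl) with hlt | hgt
          · exact mul_mem_blockFlag (blockFlag_mono (Nat.succ_le_of_lt (Fin.lt_def.1 hlt))
              (hu l j)) _
          · rw [h ⟨l, j⟩ (hi ▸ Nat.succ_le_of_lt (Fin.lt_def.1 hgt)), Matrix.mul_zero]
            exact zero_mem _
        have := hind i.1 (fun j => d ⟨i.1, j⟩) (by
          rw [eq_neg_of_add_eq_zero_left hd]
          exact neg_mem hrest)
        exact congrFun this i.2
    exact main t fun i hi => absurd hi (not_le.2 i.1.2)

/-! ### Kronecker products, conjugation and the elementary grading -/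

theorem Matrix.mul_apply_eq_zero_of_blockTriangular {α β δ R o : Type*} [Fintype β]
    [NonUnitalNonAssocSemiring R] [LinearOrder o] {A : Matrix α β R} {B : Matrix β δ R}
    {fa : α → o} {fb : β → o} {fd : δ → o}
    (hA : ∀ a b, fb b < fa a → A a b = 0) (hB : ∀ b c, fd c < fb b → B b c = 0) (a : α) (c : δ)
    (h : fd c < fa a) : (A * B) a c = 0 := by
  rw [Matrix.mul_apply]
  refine Finset.sum_eq_zero fun b _ => ?_
  rcases lt_or_ge (fb b) (fa a) with hb | hb
  · rw [hA a b hb, zero_mul]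
  · rw [hB b c (h.trans_le hb), mul_zero]

namespace UT

variable {K : Type*} [Field K] {t : ℕ} {n : Fin t → ℕ} {m : ℕ}

/-- The Kronecker product as an embedding of `UT(n₁, …, n_t) ⊗ M_m(K)` into a matrix algebra. -/
noncomputable def kronecker (K : Type*) [Field K] {t : ℕ} (n : Fin t → ℕ) (m : ℕ) :
    UT K n ⊗[K] Matrix (Fin m) (Fin m) K →ₐ[K]
      Matrix (UTIndex n × Fin m) (UTIndex n × Fin m) K :=
  (Matrix.kroneckerAlgEquiv (UTIndex n) (Fin m) K).toAlgHom.comp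
    (Algebra.TensorProduct.map (UT K n).val (AlgHom.id K _))

theorem kronecker_tmul (a : UT K n) (d : Matrix (Fin m) (Fin m) K) :
    kronecker K n m (a ⊗ₜ d) =
      Matrix.kronecker (a : Matrix (UTIndex n) (UTIndex n) K) d := by
  simp [kronecker]

theorem kronecker_injective : Function.Injective (kronecker K n m) := by
  refine (Matrix.kroneckerAlgEquiv (UTIndex n) (Fin m) K).injective.comp ?_
  exact Module.Flat.rTensor_preserves_injective_linearMap (M := Matrix (Fin m) (Fin m) K)
    (UT K n).val.toLinearMap Subtype.val_injective

theorem kronecker_apply_eq_zero (x : UT K n ⊗[K] Matrix (Fin m) (Fin m) K)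
    (p q : UTIndex n × Fin m) (h : q.1.1 < p.1.1) : kronecker K n m x p q = 0 := by
  induction x with
  | zero => simp
  | add x y hx hy => rw [map_add, Matrix.add_apply, hx, hy, add_zero]
  | tmul a d => simp [kronecker_tmul, apply_eq_zero a h]

/-- The preimage is the sum of e_ij ⊗ X_ij, where X_ij is the m × m block of X at (i, j). Together
with `kronecker_apply_eq_zero` this determines the image of the embedding. -/
theorem exists_kronecker_eq {X : Matrix (UTIndex n × Fin m) (UTIndex n × Fin m) K}
    (hX : ∀ p q, q.1.1 < p.1.1 → X p q = 0) : ∃ x, kronecker K n m x = X := by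
  refine ⟨∑ i, ∑ j, if h : i.1 ≤ j.1 then UT.unit K n i j h ⊗ₜ[K]
    (Matrix.of fun c c' => X (i, c) (j, c')) else 0, ?_⟩
  ext ⟨i, c⟩ ⟨j, c'⟩
  simp only [map_sum, Matrix.sum_apply]
  rw [Finset.sum_eq_single i, Finset.sum_eq_single j]
  · by_cases h : i.1 ≤ j.1
    · simp [h, kronecker_tmul]
    · simp [h, hX (i, c) (j, c') (not_le.1 h)]
  · intro j' _ hj
    split_ifs with h
    · simp [kronecker_tmul, hj]
    · simp
  · simp
  · intro i' _ hi
    refine Finset.sum_eq_zero fun j' _ => ?_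
    split_ifs with h
    · simp [kronecker_tmul, hi]
    · simp
  · simp

/-- Conjugation by an invertible matrix that respects the blocks identifies
`UT(n₁', …, n_t') ⊗ M_m(K)` with `UT(n₁, …, n_t)`. -/
theorem exists_algEquiv_conj {n' : Fin t → ℕ} {P : Matrix (UTIndex n) (UTIndex n' × Fin m) K}
    {Q : Matrix (UTIndex n' × Fin m) (UTIndex n) K} (hPQ : P * Q = 1) (hQP : Q * P = 1)
    (hP : ∀ p q, q.1.1 < p.1 → P p q = 0) (hQ : ∀ q p, p.1 < q.1.1 → Q q p = 0) :
    ∃ ψ : (UT K n' ⊗[K] Matrix (Fin m) (Fin m) K) ≃ₐ[K] UT K n, ∀ x,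
      (ψ x : Matrix (UTIndex n) (UTIndex n) K) = P * kronecker K n' m x * Q := by
  let c : Matrix (UTIndex n' × Fin m) (UTIndex n' × Fin m) K →ₐ[K]
      Matrix (UTIndex n) (UTIndex n) K :=
    AlgHom.ofLinearMap (mulRightLinearMap (UTIndex n) K Q ∘ₗ mulLeftLinearMap _ K P)
      (by
        change P * (1 : Matrix (UTIndex n' × Fin m) (UTIndex n' × Fin m) K) * Q = 1
        rw [Matrix.mul_one, hPQ])
      (fun X Y => by
        change P * (X * Y) * Q = P * X * Q * (P * Y * Q)
        calc P * (X * Y) * Q = P * X * (Y * Q) := by simp only [Matrix.mul_assoc]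
          _ = P * X * (Q * P) * (Y * Q) := by rw [hQP, Matrix.mul_one]
          _ = _ := by simp only [Matrix.mul_assoc])
  let ψ : (UT K n' ⊗[K] Matrix (Fin m) (Fin m) K) →ₐ[K] UT K n :=
    (c.comp (kronecker K n' m)).codRestrict (UT K n) fun x i j hij =>
      Matrix.mul_apply_eq_zero_of_blockTriangular (fa := Sigma.fst)
        (fb := fun q : UTIndex n' × Fin m => q.1.1) (fd := Sigma.fst)
        (Matrix.mul_apply_eq_zero_of_blockTriangular (fa := Sigma.fst)
          (fb := fun q : UTIndex n' × Fin m => q.1.1) (fd := fun q : UTIndex n' × Fin m => q.1.1)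
          hP (kronecker_apply_eq_zero x)) hQ i j hij
  have hψ : ∀ x, (ψ x : Matrix (UTIndex n) (UTIndex n) K) = P * kronecker K n' m x * Q :=
    fun _ => rfl
  refine ⟨AlgEquiv.ofBijective ψ ⟨fun x y hxy => kronecker_injective ?_, fun a => ?_⟩, hψ⟩
  · have h : P * kronecker K n' m x * Q = P * kronecker K n' m y * Q := by
      rw [← hψ, hxy, hψ]
    have h2 : Q * (P * kronecker K n' m x * Q) * P = Q * (P * kronecker K n' m y * Q) * P := by
      rw [h]
    simp only [← Matrix.mul_assoc, hQP, Matrix.one_mul] at h2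
    simpa only [Matrix.mul_assoc, hQP, Matrix.mul_one] using h2
  -- Block triangularity of P, a and Q makes QaP block triangular, so the inverse conjugation stays
  -- within the image of the embedding.
  · obtain ⟨x, hx⟩ := exists_kronecker_eq (X := Q * (a : Matrix (UTIndex n) (UTIndex n) K) * P)
      (Matrix.mul_apply_eq_zero_of_blockTriangular (fa := fun q : UTIndex n' × Fin m => q.1.1)
        (fb := Sigma.fst) (fd := fun q : UTIndex n' × Fin m => q.1.1)
        (Matrix.mul_apply_eq_zero_of_blockTriangular (fb := Sigma.fst) hQ
          fun _ _ h => apply_eq_zero a h) hP)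
    refine ⟨x, Subtype.ext ?_⟩
    rw [hψ, hx]
    calc P * (Q * (a : Matrix (UTIndex n) (UTIndex n) K) * P) * Q
        = P * Q * (a : Matrix (UTIndex n) (UTIndex n) K) * (P * Q) := by
          simp only [Matrix.mul_assoc]
      _ = (a : Matrix (UTIndex n) (UTIndex n) K) := by rw [hPQ, Matrix.one_mul, Matrix.mul_one]

theorem span_unit : Submodule.span K (Set.range fun p : {p : UTIndex n × UTIndex n // p.1.1 ≤ p.2.1}
    => UT.unit K n p.1.1 p.1.2 p.2) = ⊤ := by
  rw [← (Module.Basis.ofEquivFun (entriesEquiv K n)).span_eq]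
  congr 2
  funext p
  rw [Module.Basis.coe_ofEquivFun]
  exact (entriesEquiv_symm_single p).symm

variable {G : Type*} [Group G]

/-- Spanning is all that is needed here; independence will come from comparison with the transported
grading through `IsDecomposition.eq_of_le`. -/
theorem iSup_tensorGrading {γ : UTIndex n → G} {D : Type*} [Ring D] [Algebra K D]
    {𝒟 : G → Submodule K D} (h𝒟 : ⨆ g, 𝒟 g = ⊤) : ⨆ g, tensorGrading γ 𝒟 g = ⊤ := by
  refine Submodule.eq_top_iff'.2 fun x => ?_
  induction x with
  | zero => exact zero_mem _
  | add x y hx hy => exact add_mem hx hy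
  | tmul a d =>
    have ha : a ∈ Submodule.span K (Set.range
        fun p : {p : UTIndex n × UTIndex n // p.1.1 ≤ p.2.1} => UT.unit K n p.1.1 p.1.2 p.2) := by
      rw [span_unit]
      trivial
    induction ha using Submodule.span_induction with
    | zero => rw [TensorProduct.zero_tmul]; exact zero_mem _
    | add a b _ _ ha hb => rw [TensorProduct.add_tmul]; exact add_mem ha hb
    | smul c a _ ha => rw [← TensorProduct.smul_tmul']; exact Submodule.smul_mem _ c ha
    | mem a ha =>
      obtain ⟨⟨⟨i, j⟩, hij⟩, rfl⟩ := ha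
      have hle : (⨆ g, 𝒟 g) ≤ (⨆ g, tensorGrading γ 𝒟 g).comap
          (TensorProduct.mk K (UT K n) D (UT.unit K n i j hij)) := by
        refine iSup_le fun h d hd => ?_
        exact Submodule.mem_iSup_of_mem (γ i * h * (γ j)⁻¹)
          (Submodule.subset_span ⟨i, j, hij, h, d, hd, rfl, rfl⟩)
      exact hle (h𝒟 ▸ Submodule.mem_top)

/-- The homogeneous components of the elementary grading defined by `γ`. -/
def elementaryComponent (K : Type*) [Field K] {t : ℕ} {n : Fin t → ℕ} (γ : UTIndex n → G) (g : G) :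
    Submodule K (UT K n) where
  carrier := {a | ∀ i j, γ i * (γ j)⁻¹ ≠ g → (a : Matrix (UTIndex n) (UTIndex n) K) i j = 0}
  zero_mem' _ _ _ := rfl
  add_mem' {a b} ha hb i j hij := by
    rw [Subalgebra.coe_add, Matrix.add_apply, ha i j hij, hb i j hij, add_zero]
  smul_mem' c a ha i j hij := by
    rw [Subalgebra.coe_smul, Matrix.smul_apply, ha i j hij, smul_zero]

theorem isElementaryGrading_elementaryComponent (γ : UTIndex n → G) :
    IsElementaryGrading γ (elementaryComponent K γ) := by
  have hunit : ∀ (i j : UTIndex n) (hij : i.1 ≤ j.1),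
      UT.unit K n i j hij ∈ elementaryComponent K γ (γ i * (γ j)⁻¹) := by
    intro i j hij p q hpq
    rw [coe_unit]
    refine Matrix.single_apply_of_ne _ _ _ _ _ ?_
    rintro ⟨rfl, rfl⟩
    exact hpq rfl
  refine ⟨⟨fun g => ?_, ?_, fun {g h a b} ha hb i j hij => ?_⟩, hunit⟩
  · rw [Submodule.disjoint_def]
    intro a ha ha'
    ext i j
    by_cases hij : γ i * (γ j)⁻¹ = g
    · let e : UT K n →ₗ[K] K := Matrix.entryLinearMap K K i j ∘ₗ (UT K n).val.toLinearMap
      have hle : (⨆ (h) (_ : h ≠ g), elementaryComponent K γ h) ≤ LinearMap.ker e :=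
        iSup₂_le fun h hh b hb => hb i j fun e => hh (e.symm.trans hij)
      exact hle ha'
    · exact ha i j hij
  · rw [eq_top_iff, ← span_unit, Submodule.span_le]
    rintro _ ⟨p, rfl⟩
    exact Submodule.mem_iSup_of_mem _ (hunit _ _ p.2)
  · rw [Subalgebra.coe_mul, Matrix.mul_apply]
    refine Finset.sum_eq_zero fun p _ => ?_
    by_cases hip : γ i * (γ p)⁻¹ = g
    · rw [hb p j, mul_zero]
      rintro rfl
      exact hij (by rw [← hip]; group)
    · rw [ha i p hip, zero_mul]

end UT

/-! ### Comparison of the gradings -/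

theorem IsGradedModule.proj_mul_of_mem {G K : Type*} [Group G] [Field K] {t : ℕ} {n : Fin t → ℕ}
    {m : ℕ} {𝒜 : G → Submodule K (UT K n)} {𝒰 : G → Submodule K (Matrix (UTIndex n) (Fin m) K)}
    (h𝒜 : IsDecomposition 𝒜) (h𝒰 : IsGradedModule 𝒜 𝒰) {h : G}
    {x : Matrix (UTIndex n) (Fin m) K} (hx : x ∈ 𝒰 h) (g : G) (a : UT K n) :
    h𝒰.toIsDecomposition.proj (g * h) ((a : Matrix (UTIndex n) (UTIndex n) K) * x) =
      (h𝒜.proj g a : Matrix (UTIndex n) (UTIndex n) K) * x :=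
  h𝒜.proj_map h𝒰.toIsDecomposition
    (f := (mulLinearMap K).flip x ∘ₗ (UT K n).val.toLinearMap) (mul_left_injective h)
    (fun _ _ ha => h𝒰.mul_mem ha hx) g a

/-- If the columns of `P`, taken in blocks of size `m`, are homogeneous in a graded module, then
conjugation by `P` maps the grading of the tensor product into that of `UT(n₁, …, n_t)`. -/
theorem IsGradedModule.conj_unit_tmul_mem {G K : Type*} [Group G] [Field K] {t : ℕ}
    {n n' : Fin t → ℕ} {m : ℕ} {𝒜 : G → Submodule K (UT K n)}
    {𝒰 : G → Submodule K (Matrix (UTIndex n) (Fin m) K)}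
    (h𝒜 : IsDecomposition 𝒜) (h𝒰 : IsGradedModule 𝒜 𝒰)
    {u : UTIndex n' → Matrix (UTIndex n) (Fin m) K} {γ : UTIndex n' → G}
    (hu : ∀ i, u i ∈ 𝒰 (γ i)) {Q : Matrix (UTIndex n' × Fin m) (UTIndex n) K}
    (hPQ : (Matrix.of fun p q => u q.1 p q.2 : Matrix (UTIndex n) (UTIndex n' × Fin m) K) * Q = 1)
    (hQP : Q * (Matrix.of fun p q => u q.1 p q.2 : Matrix (UTIndex n) (UTIndex n' × Fin m) K) = 1)
    (a : UT K n) (i j : UTIndex n') {h : G} {d : Matrix (Fin m) (Fin m) K}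
    (hd : d ∈ rightComponent 𝒰 h)
    (ha : (a : Matrix (UTIndex n) (UTIndex n) K) =
      (Matrix.of fun p q => u q.1 p q.2 : Matrix (UTIndex n) (UTIndex n' × Fin m) K) *
        Matrix.kronecker (Matrix.single i j 1) d * Q) :
    a ∈ 𝒜 (γ i * h * (γ j)⁻¹) := by
  set P : Matrix (UTIndex n) (UTIndex n' × Fin m) K := Matrix.of fun p q => u q.1 p q.2 with hP
  have mul_P : ∀ (b : Matrix (UTIndex n) (UTIndex n) K) p l c, (b * P) p (l, c) = (b * u l) p c :=
    fun b p l c => rfl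
  have haP : (a : Matrix (UTIndex n) (UTIndex n) K) * P =
      P * Matrix.kronecker (Matrix.single i j 1) d := by
    rw [ha, Matrix.mul_assoc, hQP, Matrix.mul_one]
  -- In the basis u, the element a is the operator that sends u_j to u_i d and kills the other basis
  -- vectors.
  have hau : ∀ l, (a : Matrix (UTIndex n) (UTIndex n) K) * u l = if l = j then u i * d else 0 := by
    intro l
    ext p c
    rw [← mul_P, haP, Matrix.mul_apply, Fintype.sum_prod_type, Finset.sum_eq_single i]
    · by_cases hl : l = j
      · subst hl
        simp [P, Matrix.mul_apply]
      · simp [hl, Ne.symm hl]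
    · intro i' _ hi
      simp [Ne.symm hi]
    · simp
  refine h𝒜.mem_of_proj_eq_zero fun k hk => ?_
  -- The element a_k u_l is the component of a u_l of degree kγ_l, and a u_j is homogeneous of
  -- degree γ_i h. So a_k kills the whole basis unless k = γ_i h γ_j⁻¹.
  have hz : ∀ l, (h𝒜.proj k a : Matrix (UTIndex n) (UTIndex n) K) * u l = 0 := by
    intro l
    rw [← h𝒰.proj_mul_of_mem h𝒜 (hu l), hau]
    split_ifs with hl
    · subst hl
      refine h𝒰.toIsDecomposition.proj_of_mem_ne (fun e => hk ?_)
        (mul_mem_of_mem_rightComponent hd (hu i))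
      rw [← e, mul_inv_cancel_right]
    · exact map_zero _
  have hzP : (h𝒜.proj k a : Matrix (UTIndex n) (UTIndex n) K) * P = 0 := by
    ext p ⟨l, c⟩
    rw [mul_P, hz]
    rfl
  refine Subtype.ext ?_
  rw [← Matrix.mul_one (h𝒜.proj k a : Matrix (UTIndex n) (UTIndex n) K), ← hPQ, ← Matrix.mul_assoc,
    hzP, Matrix.zero_mul]
  rfl

/-! ### The main theorem -/

theorem mainTheorem1 {G : Type*} [Group G] {K : Type*} [Field K] {t : ℕ} (ht : 0 < t)
    (n : Fin t → ℕ) (hn : ∀ k, 0 < n k)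
    (hK : ringChar K = 0 ∨ Module.finrank K (UT K n) < ringChar K)
    (𝒜 : G → Submodule K (UT K n)) (h𝒜 : IsGroupGrading 𝒜) :
    ∃ (m : ℕ) (n' : Fin t → ℕ)
      (𝒟 : G → Submodule K (Matrix (Fin m) (Fin m) K))
      (γ : UTIndex n' → G) (ℬ : G → Submodule K (UT K n')),
      0 < m ∧ (∀ k, 0 < n' k) ∧
      IsDivisionGrading 𝒟 ∧ IsElementaryGrading γ ℬ ∧
      IsGroupGrading (K := K) (A := UT K n' ⊗[K] Matrix (Fin m) (Fin m) K) (tensorGrading γ 𝒟) ∧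
      ∃ φ : UT K n ≃ₐ[K] (UT K n' ⊗[K] Matrix (Fin m) (Fin m) K),
        ∀ g : G, (𝒜 g).map φ.toLinearMap = tensorGrading γ 𝒟 g := by
  classical
  have hex := UT.exists_isGradedModule h𝒜 hK ht hn
  obtain ⟨hm, 𝒰, h𝒰⟩ := Nat.find_spec hex
  have hmin := fun r (hr : 0 < r) (𝒱 : G → Submodule K (Matrix (UTIndex n) (Fin r) K))
    (h𝒱 : IsGradedModule 𝒜 𝒱) => Nat.find_min' hex ⟨hr, 𝒱, h𝒱⟩
  generalize Nat.find hex = m at hm 𝒰 h𝒰 hmin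
  let p₀ : UTIndex n := ⟨⟨t - 1, by omega⟩, ⟨0, hn _⟩⟩
  have hp₀ : ∀ i : UTIndex n, i.1 ≤ p₀.1 := fun i => Fin.le_def.2 (by
    have := i.1.2
    simp only [p₀]
    omega)
  have h𝒟 := h𝒰.isDivisionGrading_rightComponent h𝒜 hp₀ hmin
  obtain ⟨n', hn', u, γ, hflag, hγ, hspan, hind⟩ := h𝒰.exists_adapted_basis h𝒜 hK hn h𝒟 hm
  -- Any fixed column serves: column c₀ of ∑ u_i d_i is P applied to the stacked columns c₀ of the
  -- d_i. Expanding the matrix units in this column therefore gives the columns of a right inverse Q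
  -- of P.
  let c₀ : Fin m := ⟨0, hm⟩
  set P : Matrix (UTIndex n) (UTIndex n' × Fin m) K := Matrix.of fun p q => u q.1 p q.2 with hP
  have hcol : ∀ p : UTIndex n, ∃ d : UTIndex n' → Matrix (Fin m) (Fin m) K,
      (∀ i, p.1 < i.1 → d i = 0) ∧ ∑ i, u i * d i = Matrix.single p c₀ 1 := by
    intro p
    obtain ⟨d, hd, hsum⟩ := hspan (p.1 + 1) (Matrix.single p c₀ 1) (by
      intro i c hi
      refine Matrix.single_apply_of_ne _ _ _ _ _ ?_
      rintro ⟨rfl, -⟩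
      exact absurd hi (Nat.not_succ_le_self _))
    exact ⟨d, fun i hi => hd i (Fin.lt_def.1 hi), hsum⟩
  choose e he hesum using hcol
  let Q : Matrix (UTIndex n' × Fin m) (UTIndex n) K := Matrix.of fun q p => e p q.1 q.2 c₀
  have hPQ : P * Q = 1 := by
    ext p p'
    have := congrFun (congrFun (hesum p') p) c₀
    rw [Matrix.sum_apply] at this
    rw [Matrix.mul_apply, Fintype.sum_prod_type]
    simp only [Matrix.mul_apply] at this
    refine this.trans ?_
    rw [Matrix.single_apply, Matrix.one_apply]
    simp [eq_comm]
  -- A column of X killed by P is cut into pieces of length m; the i-th piece, repeated in every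
  -- column, forms d_i, and the independence of u over D applies.
  have hinj : ∀ X : Matrix (UTIndex n' × Fin m) (UTIndex n' × Fin m) K, P * X = 0 → X = 0 := by
    intro X hX
    ext ⟨i, c⟩ q
    have := hind (fun i => Matrix.of fun c _ => X (i, c) q) (by
      ext p c'
      have := congrFun (congrFun hX p) q
      rw [Matrix.mul_apply, Fintype.sum_prod_type] at this
      rw [Matrix.sum_apply]
      exact this)
    exact congrFun (congrFun (congrFun this i) c) c₀
  -- The index types of P are not known to have the same size, so the left inverse comes from P(QP −
  -- 1) = 0 and injectivity.
  have hQP : Q * P = 1 := by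
    refine sub_eq_zero.1 (hinj _ ?_)
    rw [Matrix.mul_sub, ← Matrix.mul_assoc, hPQ, Matrix.one_mul, Matrix.mul_one, sub_self]
  obtain ⟨ψ, hψ⟩ := UT.exists_algEquiv_conj hPQ hQP
    (fun p q h => hflag q.1 p q.2 (Nat.succ_le_of_lt (Fin.lt_def.1 h)))
    (fun q p h => by
      change e p q.1 q.2 c₀ = 0
      rw [he p q.1 h]
      rfl)
  have hle : ∀ g, tensorGrading γ (rightComponent 𝒰) g ≤ (𝒜 g).map ψ.symm.toLinearMap := by
    intro g
    refine Submodule.span_le.2 ?_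
    rintro _ ⟨i, j, hij, h, d, hd, rfl, rfl⟩
    refine ⟨ψ (UT.unit K n' i j hij ⊗ₜ d), ?_, ψ.symm_apply_apply _⟩
    refine h𝒰.conj_unit_tmul_mem h𝒜.isDecomposition hγ hPQ hQP _ i j hd ?_
    rw [hψ, UT.kronecker_tmul, UT.coe_unit]
  have hgr := h𝒜.map_algEquiv (B := UT K n' ⊗[K] Matrix (Fin m) (Fin m) K) ψ.symm
  -- Each component of the tensor product is contained in a transported component of 𝒜, and together
  -- they span, so the inclusions are equalities; this also shows that the tensor components form a
  -- grading.
  have heq := hgr.isDecomposition.eq_of_le hle (UT.iSup_tensorGrading h𝒟.iSup_eq_top)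
  refine ⟨m, n', rightComponent 𝒰, γ, UT.elementaryComponent K γ, hm, hn', h𝒟,
    UT.isElementaryGrading_elementaryComponent γ, ?_, ψ.symm, fun g => (heq g).symm⟩
  rw [show tensorGrading γ (rightComponent 𝒰) = _ from funext heq]
  exact hgr
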